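/- A Markov decision process (MDP) is a tuple $\mathcal M=\langle Q,\mathsf A,\delta\rangle$ with a finite set $Q$ of states, a finite set $\mathsf A$ of actions and a transition function $\delta:Q\times\mathsf A\to\mathcal D(Q)$, where $\mathcal D(S)$ is the set of probability distributions over a finite set $S$. A finite path of length $n$ is a sequence $\rho=q_0a_0q_1\dots a_{n-1}q_n$ with $\delta(q_i,a_i)(q_{i+1})>0$ for all $i<n$. A strategy is a function $\alpha$ that maps every finite path to a distribution in $\mathcal D(\mathsf A)$. Given $d_0\in\mathcal D(Q)$ and a strategy $\alpha$, let $\mathcal M^\alpha_n\in\mathcal D(Q)$ be the distribution over states after $n$ steps; that is, $\mathcal M^\alpha_n(q)$ is the sum of $$d_0(q_0)\cdot\prod_{j=0}^{n-1}\alpha(q_0a_0\dots q_j)(a_j)\cdot\delta(q_j,a_j)(q_{j+1})$$ over all finite paths $q_0a_0\dots q_n$ of length $n$ with $q_n=q$. For $T\subseteq Q$ and $X\in\mathcal D(Q)$ let $\mathit{sum}_T(X)=\sum_{q\in T}X(q)$. For weak synchronization according to $\mathit{sum}_T$, the almost-sure winning region is the set of all $d_0\in\mathcal D(Q)$ for which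 there exists a strategy $\alpha$ such that for all $\epsilon>0$ we have $\mathit{sum}_T(\mathcal M^\alpha_n)\ge 1-\epsilon$ for infinitely many $n$. The limit-sure winning region is the set of all $d_0\in\mathcal D(Q)$ such that for all $\epsilon>0$ there exists a strategy $\alpha$ (which may depend on $\epsilon$) with $\mathit{sum}_T(\mathcal M^\alpha_n)\ge 1-\epsilon$ for infinitely many $n$. Theorem. For every MDP $\mathcal M$ and every target set $T\subseteq Q$, the limit-sure and the almost-sure winning regions for weak synchronization according to $\mathit{sum}_T$ coincide. -/

import Mathlib

/-- Probability distributions over a finite set `S`: nonnegative real functions of total sum `1`. -/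
abbrev ProbDist (S : Type*) [Fintype S] : Type _ := stdSimplex ℝ S

/-- A Markov decision process with state set `Q`, action set `A` and probabilistic transition
function `δ`. -/
structure MDP (Q A : Type*) [Fintype Q] where
  δ : Q → A → ProbDist Q

namespace MDP

variable {Q A : Type*} [Fintype Q]

/-- The support of `δ(q, a)`. -/
def post (M : MDP Q A) (q : Q) (a : A) : Set Q := {q' | 0 < (M.δ q a).1 q'}

/-- `M.FinPath n q` is the set of finite paths `q₀ a₀ q₁ a₁ … qₙ` of length `n` in `M` with last
state `qₙ = q`, where each `qᵢ₊₁` belongs to `post qᵢ aᵢ`. -/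
inductive FinPath (M : MDP Q A) : ℕ → Q → Type _
  | nil (q : Q) : FinPath M 0 q
  | snoc {n : ℕ} {q : Q} (ρ : FinPath M n q) (a : A) (q' : Q) (h : q' ∈ M.post q a) :
      FinPath M (n + 1) q'

/-- A finite path of length `0` is just a state. -/
def FinPath.equivZero (M : MDP Q A) (q : Q) : M.FinPath 0 q ≃ Unit where
  toFun _ := ()
  invFun _ := .nil q
  left_inv ρ := by cases ρ; rfl
  right_inv _ := rfl

/-- A finite path of length `n + 1` is a finite path of length `n` extended by one step. -/
def FinPath.equivSucc (M : MDP Q A) (n : ℕ) (q' : Q) :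
    M.FinPath (n + 1) q' ≃ (Σ q : Q, Σ a : A, M.FinPath n q × PLift (q' ∈ M.post q a)) where
  toFun ρ := match ρ with
    | .snoc (q := q) ρ a _ h => ⟨q, a, ρ, ⟨h⟩⟩
  invFun x := .snoc x.2.2.1 x.2.1 q' x.2.2.2.down
  left_inv ρ := by cases ρ; rfl
  right_inv _ := rfl

theorem FinPath.finite [Finite A] (M : MDP Q A) (n : ℕ) (q : Q) : Finite (M.FinPath n q) := by
  induction n generalizing q with
  | zero => exact Finite.of_equiv _ (FinPath.equivZero M q).symm
  | succ n ih =>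
    have := ih
    exact Finite.of_equiv _ (FinPath.equivSucc M n q).symm

noncomputable instance FinPath.instFintype [Finite A] (M : MDP Q A) (n : ℕ) (q : Q) :
    Fintype (M.FinPath n q) :=
  have := FinPath.finite M n q
  Fintype.ofFinite _

variable [Fintype A]

/-- A (randomized, history-dependent) strategy: a function from finite paths to distributions
over actions. -/
def Strategy (M : MDP Q A) : Type _ := ∀ ⦃n : ℕ⦄ ⦃q : Q⦄, M.FinPath n q → ProbDist A

/-- The probability `d₀(q₀) · ∏ⱼ α(q₀ a₀ … qⱼ)(aⱼ) · δ(qⱼ, aⱼ)(qⱼ₊₁)` of a finite path, under the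
strategy `α` from the initial distribution `d₀`. -/
def pathProb (M : MDP Q A) (α : M.Strategy) (d₀ : ProbDist Q) :
    ∀ {n : ℕ} {q : Q}, M.FinPath n q → ℝ
  | _, _, .nil q => d₀.1 q
  | _, _, .snoc (q := q) ρ a q' _ => pathProb M α d₀ ρ * ((α ρ).1 a * (M.δ q a).1 q')

/-- The probability to be in state `q` after exactly `n` steps: the total probability of the finite
paths of length `n` that end in `q`. -/
noncomputable def stateProb (M : MDP Q A) (α : M.Strategy) (d₀ : ProbDist Q) (n : ℕ) (q : Q) : ℝ :=
  ∑ ρ : M.FinPath n q, M.pathProb α d₀ ρ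

theorem pathProb_nonneg (M : MDP Q A) (α : M.Strategy) (d₀ : ProbDist Q) {n : ℕ} {q : Q}
    (ρ : M.FinPath n q) : 0 ≤ M.pathProb α d₀ ρ := by
  induction ρ with
  | nil q => exact d₀.2.1 q
  | snoc ρ a q' h ih => exact mul_nonneg ih (mul_nonneg ((α ρ).2.1 a) ((M.δ _ a).2.1 q'))

theorem stateProb_zero (M : MDP Q A) (α : M.Strategy) (d₀ : ProbDist Q) (q : Q) :
    M.stateProb α d₀ 0 q = d₀.1 q := by
  unfold stateProb
  rw [← (FinPath.equivZero M q).symm.sum_comp]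
  simp [FinPath.equivZero, pathProb]

theorem stateProb_succ (M : MDP Q A) (α : M.Strategy) (d₀ : ProbDist Q) (n : ℕ) (q' : Q) :
    M.stateProb α d₀ (n + 1) q' =
      ∑ q : Q, ∑ a : A, ∑ ρ : M.FinPath n q,
        M.pathProb α d₀ ρ * ((α ρ).1 a * (M.δ q a).1 q') := by
  classical
  unfold stateProb
  rw [← (FinPath.equivSucc M n q').symm.sum_comp, Fintype.sum_sigma]
  refine Finset.sum_congr rfl fun q _ => ?_
  rw [Fintype.sum_sigma]
  refine Finset.sum_congr rfl fun a _ => ?_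
  rw [Fintype.sum_prod_type]
  refine Finset.sum_congr rfl fun ρ _ => ?_
  by_cases h : q' ∈ M.post q a
  · rw [Fintype.sum_eq_single (⟨h⟩ : PLift (q' ∈ M.post q a))
      (fun x hx => absurd (Subsingleton.elim _ _) hx)]
    rfl
  · have h0 : (M.δ q a).1 q' = 0 := le_antisymm (not_lt.mp h) ((M.δ q a).2.1 q')
    have : IsEmpty (PLift (q' ∈ M.post q a)) := ⟨fun x => h x.down⟩
    simp [h0]

theorem stateProb_mem (M : MDP Q A) (α : M.Strategy) (d₀ : ProbDist Q) (n : ℕ) :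
    M.stateProb α d₀ n ∈ stdSimplex ℝ Q := by
  refine ⟨fun q => Finset.sum_nonneg fun ρ _ => M.pathProb_nonneg α d₀ ρ, ?_⟩
  induction n with
  | zero => simpa only [stateProb_zero] using d₀.2.2
  | succ n ih =>
    rw [← ih]
    simp only [stateProb_succ]
    rw [Finset.sum_comm]
    refine Finset.sum_congr rfl fun q _ => ?_
    rw [Finset.sum_comm]
    calc ∑ a : A, ∑ q' : Q, ∑ ρ : M.FinPath n q,
          M.pathProb α d₀ ρ * ((α ρ).1 a * (M.δ q a).1 q')
        = ∑ a : A, ∑ ρ : M.FinPath n q, M.pathProb α d₀ ρ * (α ρ).1 a := by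
          refine Finset.sum_congr rfl fun a _ => ?_
          rw [Finset.sum_comm]
          refine Finset.sum_congr rfl fun ρ _ => ?_
          rw [← Finset.mul_sum, ← Finset.mul_sum, (M.δ q a).2.2, mul_one]
      _ = M.stateProb α d₀ n q := by
          rw [Finset.sum_comm]
          refine Finset.sum_congr rfl fun ρ _ => ?_
          rw [← Finset.mul_sum, (α ρ).2.2, mul_one]

/-- The symbolic outcome of the strategy `α` from `d₀`: the sequence of the distributions over
states after `n` steps. -/
noncomputable def outcome (M : MDP Q A) (α : M.Strategy) (d₀ : ProbDist Q) (n : ℕ) : ProbDist Q :=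
  ⟨M.stateProb α d₀ n, M.stateProb_mem α d₀ n⟩

end MDP

/-- `sum_T`: the probability mass that a distribution puts on `T`. -/
def sumOn {Q : Type*} [Fintype Q] (T : Finset Q) (X : ProbDist Q) : ℝ := ∑ q ∈ T, X.1 q

/-- A distribution is `p`-synchronized according to `f` if its value under `f` is at least `p`. -/
def IsSynchronized {Q : Type*} [Fintype Q] (f : ProbDist Q → ℝ) (p : ℝ) (X : ProbDist Q) : Prop :=
  p ≤ f X

/-- A sequence of distributions is weakly `p`-synchronizing according to `f` if infinitely many of
its members are `p`-synchronized. -/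
def WeaklySynchronizing {Q : Type*} [Fintype Q] (f : ProbDist Q → ℝ) (p : ℝ) (X : ℕ → ProbDist Q) : Prop :=
  {n : ℕ | IsSynchronized f p (X n)}.Infinite

namespace MDP

variable {Q A : Type*} [Fintype Q] [Fintype A]

/-- The almost-sure winning region for weak synchronization: a single strategy works for all
`ε > 0`. -/
def winAlmostSureWeakly (M : MDP Q A) (f : ProbDist Q → ℝ) : Set (ProbDist Q) :=
  {d₀ | ∃ α : M.Strategy, ∀ ε : ℝ, 0 < ε → WeaklySynchronizing f (1 - ε) (M.outcome α d₀)}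

/-- The limit-sure winning region for weak synchronization: the strategy may depend on `ε > 0`. -/
def winLimitSureWeakly (M : MDP Q A) (f : ProbDist Q → ℝ) : Set (ProbDist Q) :=
  {d₀ | ∀ ε : ℝ, 0 < ε → ∃ α : M.Strategy, WeaklySynchronizing f (1 - ε) (M.outcome α d₀)}

end MDP

/-! By compactness, limit-sure runs recur near one distribution `e` supported in `T`. Let `S` be its
support. Passing twice near `e` shows that from every state of `S`, `S` can be reached again with
probability close to 1 at a common positive time, because each state of `S` carries mass bounded
below while little mass is lost. Likewise `S` is limit-surely reachable from `d₀`. It remains to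
build one strategy that hits `S` repeatedly with errors tending to 0.

Hitting values become comparable along an eventual period `r` (`exists_period`), so from a state of
`limitRegion S r l` all late horizons congruent to `l` modulo `r` are good. These regions depend
only on `l` modulo `r`, which makes all gaps uniform. Some action always stays inside the regions,
and following such actions multiplies the loss by at most `1/b`, independently of the horizon
(`one_sub_policyValue_le`). Since a safe phase ends surely in `limitRegion S r 0`, even its failures
can start the next, more accurate phase. -/

open Filter

namespace MDP

variable {Q A : Type*} [Fintype Q] [Fintype A]

/-! ### Bellman operator and hitting values. -/

/-- The expected value of `u` after playing `a` in `q`. -/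
noncomputable def expect (M : MDP Q A) (u : Q → ℝ) (q : Q) (a : A) : ℝ :=
  ∑ q', (M.δ q a).1 q' * u q'

-- Transition probabilities sum to 1, so affine bounds survive averaging. With `d = 1 - c` the bound
-- reads `c * (1 - v) ≤ 1 - u`, the form in which losses are compared below.
omit [Fintype A] in
theorem expect_le_affine (M : MDP Q A) {u v : Q → ℝ} {c d : ℝ} {q : Q} {a : A}
    (h : ∀ q' ∈ M.post q a, u q' ≤ c * v q' + d) : M.expect u q a ≤ c * M.expect v q a + d := by
  have h1 := (M.δ q a).2.2
  calc M.expect u q a ≤ ∑ q', (M.δ q a).1 q' * (c * v q' + d) := by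
        refine Finset.sum_le_sum fun q' _ => ?_
        rcases ((M.δ q a).2.1 q').eq_or_lt with h0 | h0
        · simp [← h0]
        · exact mul_le_mul_of_nonneg_left (h q' h0) h0.le
    _ = c * M.expect v q a + d * ∑ q', (M.δ q a).1 q' := by
        rw [expect, Finset.mul_sum, Finset.mul_sum, ← Finset.sum_add_distrib]
        exact Finset.sum_congr rfl fun q' _ => by ring
    _ = c * M.expect v q a + d := by rw [h1, mul_one]

section Bellman

variable [Nonempty A]

/-- The Bellman operator: the optimal expectation of `u` after one step. -/
noncomputable def bellman (M : MDP Q A) (u : Q → ℝ) (q : Q) : ℝ :=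
  Finset.univ.sup' Finset.univ_nonempty (M.expect u q)

theorem expect_le_bellman (M : MDP Q A) (u : Q → ℝ) (q : Q) (a : A) :
    M.expect u q a ≤ M.bellman u q :=
  Finset.le_sup' (M.expect u q) (Finset.mem_univ a)

theorem exists_bellman_eq (M : MDP Q A) (u : Q → ℝ) (q : Q) :
    ∃ a, M.bellman u q = M.expect u q a := by
  obtain ⟨a, -, h⟩ := Finset.exists_mem_eq_sup' Finset.univ_nonempty (M.expect u q)
  exact ⟨a, h⟩

theorem bellman_le_affine (M : MDP Q A) {u v : Q → ℝ} {c d : ℝ} (hc : 0 ≤ c)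
    (h : ∀ q, u q ≤ c * v q + d) (q : Q) : M.bellman u q ≤ c * M.bellman v q + d := by
  obtain ⟨a, ha⟩ := M.exists_bellman_eq u q
  rw [ha]
  have h1 := M.expect_le_affine (q := q) (a := a) fun q' _ => h q'
  have h2 := mul_le_mul_of_nonneg_left (M.expect_le_bellman v q a) hc
  linarith

theorem bellman_iterate_le_affine (M : MDP Q A) {u v : Q → ℝ} {c d : ℝ} (hc : 0 ≤ c)
    (h : ∀ q, u q ≤ c * v q + d) (n : ℕ) (q : Q) :
    M.bellman^[n] u q ≤ c * M.bellman^[n] v q + d := by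
  induction n generalizing q with
  | zero => exact h q
  | succ n ih =>
    rw [Function.iterate_succ_apply', Function.iterate_succ_apply']
    exact M.bellman_le_affine hc ih q

/-- The optimal probability to be in `S` after exactly `n` steps. -/
noncomputable def hitValue (M : MDP Q A) (S : Set Q) (n : ℕ) : Q → ℝ :=
  M.bellman^[n] (S.indicator 1)

variable (M : MDP Q A) (S : Set Q)

theorem hitValue_zero : M.hitValue S 0 = S.indicator 1 := rfl

theorem hitValue_succ (n : ℕ) : M.hitValue S (n + 1) = M.bellman (M.hitValue S n) :=
  Function.iterate_succ_apply' _ _ _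

theorem bellman_iterate_hitValue (k n : ℕ) :
    M.bellman^[k] (M.hitValue S n) = M.hitValue S (k + n) :=
  (Function.iterate_add_apply _ _ _ _).symm

theorem hitValue_le_one (n : ℕ) (q : Q) : M.hitValue S n q ≤ 1 := by
  have := M.bellman_iterate_le_affine (u := S.indicator 1) (v := 0) (c := 0) (d := 1) le_rfl
    (fun q => by by_cases h : q ∈ S <;> simp [h]) n q
  simpa [hitValue] using this

theorem hitValue_nonneg (n : ℕ) (q : Q) : 0 ≤ M.hitValue S n q := by
  induction n generalizing q with
  | zero => by_cases h : q ∈ S <;> simp [hitValue_zero, h]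
  | succ n ih =>
    rw [hitValue_succ]
    exact (Finset.sum_nonneg fun q' _ => mul_nonneg ((M.δ q _).2.1 q') (ih q')).trans
      (M.expect_le_bellman _ q (Classical.arbitrary A))

/-- Finitely many positive thresholds can be replaced by a common one. -/
theorem exists_uniform_gap {ι : Type*} [Finite ι] {P : ι → ℝ → Prop}
    (hP : ∀ i c c', 0 < c' → c' ≤ c → P i c → P i c') (h : ∀ i, ∃ c > 0, P i c) :
    ∃ c > 0, c ≤ 1 ∧ ∀ i, P i c := by
  have := Fintype.ofFinite ι
  choose c hc hPc using h
  rcases isEmpty_or_nonempty ι with hι | hι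
  · exact ⟨1, one_pos, le_rfl, fun i => isEmptyElim i⟩
  · have hpos : 0 < Finset.univ.inf' Finset.univ_nonempty c :=
      (Finset.lt_inf'_iff _).2 fun i _ => hc i
    refine ⟨min 1 (Finset.univ.inf' Finset.univ_nonempty c), lt_min one_pos hpos,
      min_le_left _ _, fun i => hP i _ _ (lt_min one_pos hpos) ?_ (hPc i)⟩
    exact (min_le_right _ _).trans (Finset.inf'_le _ (Finset.mem_univ i))

/-- Up to a constant factor, the distance of the hitting values to `1` does not increase along an
eventual period. -/
theorem exists_period : ∃ K r : ℕ, ∃ c : ℝ, 0 < r ∧ 0 < c ∧ c ≤ 1 ∧ ∀ n, K ≤ n → ∀ m q,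
    M.hitValue S n q ≤ c * M.hitValue S (n + m * r) q + (1 - c) := by
  -- Pigeonhole: `Q` has finitely many subsets, so two horizons share their set of states of value
  -- exactly 1.
  obtain ⟨K, L, hKL, hR⟩ : ∃ K L : ℕ, K < L ∧
      {q | M.hitValue S K q = 1} = {q | M.hitValue S L q = 1} := by
    obtain ⟨x, y, hxy, h⟩ := Finite.exists_ne_map_eq_of_infinite
      fun n : ℕ => {q | M.hitValue S n q = 1}
    rcases hxy.lt_or_gt with hlt | hlt
    · exact ⟨x, y, hlt, h⟩
    · exact ⟨y, x, hlt, h.symm⟩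
  obtain ⟨r, rfl⟩ := Nat.exists_eq_add_of_lt hKL
  set R : Set Q := {q | M.hitValue S K q = 1} with hRdef
  obtain ⟨c, hc, hc1, hgap⟩ := exists_uniform_gap (ι := Q)
    (P := fun q c => q ∉ R → M.hitValue S K q ≤ 1 - c)
    (fun q c c' _ hle h hq => (h hq).trans (by linarith))
    (fun q => by
      by_cases hq : q ∈ R
      · exact ⟨1, one_pos, fun h => absurd hq h⟩
      · exact ⟨1 - M.hitValue S K q, sub_pos.2 ((M.hitValue_le_one S K q).lt_of_ne hq),
          fun _ => by simp⟩)
  have hup : ∀ q, M.hitValue S K q ≤ c * R.indicator 1 q + (1 - c) := fun q => by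
    by_cases hq : q ∈ R
    · simpa [hq] using M.hitValue_le_one S K q
    · simpa [hq] using hgap q hq
  -- On `R` the value at horizon `K + r + 1` is 1. Any chance of missing `R` after `r + 1` steps
  -- would cost a factor `c`, so `R` returns to itself with probability 1.
  have hstep : ∀ q, R.indicator 1 q ≤ M.hitValue R (r + 1) q := fun q => by
    by_cases hq : q ∈ R
    · have h1 := M.bellman_iterate_le_affine hc.le hup (r + 1) q
      have h2 : M.hitValue S (K + r + 1) q = 1 := by
        have : q ∈ {q | M.hitValue S (K + r + 1) q = 1} := hR ▸ hq
        exact this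
      rw [bellman_iterate_hitValue, show r + 1 + K = K + r + 1 by ring, h2] at h1
      have h3 : c * 1 ≤ c * M.hitValue R (r + 1) q := by
        change 1 ≤ c * M.hitValue R (r + 1) q + (1 - c) at h1
        linarith
      simpa [hq] using le_of_mul_le_mul_left h3 hc
    · simpa [hq] using M.hitValue_nonneg R (r + 1) q
  have hret : ∀ m q, R.indicator 1 q ≤ M.hitValue R (m * (r + 1)) q := fun m => by
    induction m with
    | zero => intro q; simp [hitValue_zero]
    | succ m ih =>
      intro q
      have h := M.bellman_iterate_le_affine (c := 1) (d := 0) zero_le_one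
        (fun q => by simpa using ih q) (r + 1) q
      rw [bellman_iterate_hitValue, one_mul, add_zero] at h
      rw [add_mul, one_mul, add_comm]
      exact (hstep q).trans h
  have hlow : ∀ q, R.indicator 1 q ≤ M.hitValue S K q := fun q => by
    by_cases hq : q ∈ R
    · have : M.hitValue S K q = 1 := hq
      simp [hq, this]
    · simpa [hq] using M.hitValue_nonneg S K q
  refine ⟨K, r + 1, c, r.succ_pos, hc, hc1, fun n hn m q => ?_⟩
  obtain ⟨k, rfl⟩ := Nat.exists_eq_add_of_le' hn
  -- Off `R` the constant `1 - c` suffices; from `R`, return to `R` for `m` periods, then spend the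
  -- last `K` steps reaching `S`.
  have hbase : ∀ q, M.hitValue S K q ≤ c * M.hitValue S (K + m * (r + 1)) q + (1 - c) := by
    intro q
    have h1 := M.bellman_iterate_le_affine (c := 1) (d := 0) zero_le_one
      (fun q => by simpa using hlow q) (m * (r + 1)) q
    rw [bellman_iterate_hitValue, one_mul, add_zero, add_comm _ K] at h1
    have h2 := mul_le_mul_of_nonneg_left ((hret m q).trans h1) hc.le
    linarith [hup q]
  have h := M.bellman_iterate_le_affine hc.le hbase k q
  rwa [bellman_iterate_hitValue, bellman_iterate_hitValue, ← add_assoc] at h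

/-! ### Limit regions and safe actions. -/

/-- The states from which the probability to be in `S` after `l + m * r` steps can be made
arbitrarily close to `1`. -/
def limitRegion (r l : ℕ) : Set Q :=
  {q | ∀ ε > 0, ∃ m : ℕ, 1 - ε ≤ M.hitValue S (l + m * r) q}

/-- `S` is limit-surely recurrent: from every state of `S` the set `S` is reached with probability
arbitrarily close to `1`, at a common positive time. -/
def IsLimitRecurrent : Prop := ∀ ε > 0, ∃ n > 0, ∀ q ∈ S, 1 - ε ≤ M.hitValue S n q

variable {M S}

/-- Concatenating `N * r` returns to `S` makes the delay a multiple of `r`; the losses add up to at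
most `ε`. -/
theorem IsLimitRecurrent.exists_le_add (hS : M.IsLimitRecurrent S) (r N : ℕ) {ε : ℝ} (hε : 0 < ε) :
    ∃ p ≥ N, ∀ k q, M.hitValue S k q ≤ M.hitValue S (k + p * r) q + ε := by
  obtain ⟨n, hn, h⟩ := hS (ε / (N * r + 1)) (by positivity)
  have hone : ∀ k q, M.hitValue S k q ≤ M.hitValue S (k + n) q + ε / (N * r + 1) := by
    intro k q
    have := M.bellman_iterate_le_affine (u := S.indicator 1) (v := M.hitValue S n) (c := 1)
      (d := ε / (N * r + 1)) zero_le_one (fun q => by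
        by_cases hq : q ∈ S
        · have := h q hq
          simp only [hq, Set.indicator_of_mem, Pi.one_apply]
          linarith
        · have := M.hitValue_nonneg S n q
          have h' : 0 ≤ ε / ((N : ℝ) * r + 1) := by positivity
          simp only [hq, not_false_eq_true, Set.indicator_of_notMem]
          linarith) k q
    rwa [bellman_iterate_hitValue, one_mul] at this
  have hmany : ∀ j k q,
      M.hitValue S k q ≤ M.hitValue S (k + j * n) q + j * (ε / (N * r + 1)) := by
    intro j
    induction j with
    | zero => intro k q; simp
    | succ j ih =>
      intro k q
      have h1 := ih k q
      have h2 := hone (k + j * n) q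
      rw [show k + (j + 1) * n = k + j * n + n by ring]
      push_cast
      linarith
  refine ⟨N * n, Nat.le_mul_of_pos_right N hn, fun k q => ?_⟩
  have h1 := hmany (N * r) k q
  rw [show N * r * n = N * n * r by ring] at h1
  have h2 : ((N * r : ℕ) : ℝ) * (ε / (N * r + 1)) ≤ ε := by
    push_cast
    rw [mul_div_assoc', div_le_iff₀ (by positivity)]
    linarith
  linarith

section Period

variable {K r : ℕ} {c : ℝ} (hS : M.IsLimitRecurrent S) (hr : 0 < r) (hc : 0 < c)
  (hper : ∀ n, K ≤ n → ∀ m q,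
    M.hitValue S n q ≤ c * M.hitValue S (n + m * r) q + (1 - c))

include hS hr hc hper

/-- Recurrence pushes one good horizon beyond `K`, after which `hper` covers all later ones; the
accuracy `c * ε` pays for its factor `1 / c`. -/
theorem eventually_le_hitValue_of_mem_limitRegion {l : ℕ} {q : Q} (hq : q ∈ M.limitRegion S r l)
    {ε : ℝ} (hε : 0 < ε) : ∀ᶠ m : ℕ in atTop, 1 - ε ≤ M.hitValue S (l + m * r) q := by
  obtain ⟨m, hm⟩ := hq (c * ε / 2) (by positivity)
  obtain ⟨p, hp, h⟩ := hS.exists_le_add r K (ε := c * ε / 2) (by positivity)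
  filter_upwards [eventually_ge_atTop (m + p)] with x hx
  obtain ⟨y, rfl⟩ := Nat.exists_eq_add_of_le hx
  have h1 := h (l + m * r) q
  have h2 := hper (l + m * r + p * r) (by nlinarith) y q
  rw [show l + m * r + p * r + y * r = l + (m + p + y) * r by ring] at h2
  have h3 : c * (1 - ε) ≤ c * M.hitValue S (l + (m + p + y) * r) q := by linarith
  exact le_of_mul_le_mul_left h3 hc

theorem limitRegion_add_mul (l k : ℕ) : M.limitRegion S r (l + k * r) = M.limitRegion S r l := by
  ext q
  constructor
  · intro h ε hε
    obtain ⟨m, hm⟩ := h ε hε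
    exact ⟨k + m, by rwa [add_mul, ← add_assoc]⟩
  · intro h ε hε
    obtain ⟨m, hm, hk⟩ := ((eventually_le_hitValue_of_mem_limitRegion hS hr hc hper h hε).and
      (eventually_ge_atTop k)).exists
    obtain ⟨y, rfl⟩ := Nat.exists_eq_add_of_le hk
    exact ⟨y, by rwa [add_assoc, ← add_mul]⟩

/-- By periodicity only finitely many pairs (residue, state) matter, so one gap serves every `l`. -/
theorem exists_hitValue_gap : ∃ b > 0, b ≤ 1 ∧ ∀ l, ∀ q ∉ M.limitRegion S r l,
    M.hitValue S l q ≤ 1 - b := by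
  obtain ⟨b, hb, hb1, h⟩ := exists_uniform_gap (ι := Fin r × Q)
    (P := fun i b => i.2 ∉ M.limitRegion S r i.1 →
      ∀ m : ℕ, M.hitValue S (i.1 + m * r) i.2 ≤ 1 - b)
    (fun i b b' _ hle h hi m => (h hi m).trans (by linarith))
    (fun i => by
      by_cases hi : i.2 ∈ M.limitRegion S r i.1
      · exact ⟨1, one_pos, fun h => absurd hi h⟩
      · have hi' := hi
        simp only [limitRegion, Set.mem_ofPred_eq, not_forall, not_exists, not_le] at hi'
        obtain ⟨ε, hε, h⟩ := hi'
        exact ⟨ε, hε, fun _ m => (h m).le⟩)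
  refine ⟨b, hb, hb1, fun l q hq => ?_⟩
  have hl : l % r + l / r * r = l := by rw [mul_comm]; exact Nat.mod_add_div l r
  have h1 := h (⟨l % r, Nat.mod_lt l hr⟩, q)
  rw [← hl, limitRegion_add_mul hS hr hc hper] at hq
  have h2 := h1 hq (l / r)
  simpa only [hl] using h2

/-- Leaving the region has at least the least positive transition probability `p`, and then costs at
least the gap `b`. -/
theorem exists_expect_gap : ∃ b > 0, b ≤ 1 ∧ ∀ l q a, (¬ M.post q a ⊆ M.limitRegion S r l) →
    M.expect (M.hitValue S l) q a ≤ 1 - b := by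
  obtain ⟨b, hb, hb1, hgap⟩ := exists_hitValue_gap hS hr hc hper
  obtain ⟨p, hp, hp1, hprob⟩ := exists_uniform_gap (ι := Q × A × Q)
    (P := fun i p => i.2.2 ∈ M.post i.1 i.2.1 → p ≤ (M.δ i.1 i.2.1).1 i.2.2)
    (fun i b b' _ hle h hi => hle.trans (h hi))
    (fun i => by
      by_cases hi : i.2.2 ∈ M.post i.1 i.2.1
      · exact ⟨_, hi, fun _ => le_rfl⟩
      · exact ⟨1, one_pos, fun h => absurd h hi⟩)
  classical
  refine ⟨p * b, by positivity, by nlinarith, fun l q a ha => ?_⟩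
  obtain ⟨q', hq', hq'D⟩ := Set.not_subset.1 ha
  have h1 := hprob (q, a, q') hq'
  have h2 := hgap l q' hq'D
  have h3 : M.expect (M.hitValue S l) q a
      ≤ ∑ x, ((M.δ q a).1 x - if x = q' then p * b else 0) := by
    refine Finset.sum_le_sum fun x _ => ?_
    have hx := M.hitValue_le_one S l x
    have hx0 := (M.δ q a).2.1 x
    split_ifs with hxq
    · subst hxq
      have h1' : p ≤ (M.δ q a).1 x := h1
      nlinarith
    · nlinarith
  rw [Finset.sum_sub_distrib, (M.δ q a).2.2] at h3
  simpa using h3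

/-- Some action keeps the process in the limit region; moreover it is optimal, unless the value is
bounded away from `1`. -/
theorem exists_safe_action : ∃ b > 0, b ≤ 1 ∧ ∀ l, ∀ q ∈ M.limitRegion S r (l + 1),
    ∃ a, M.post q a ⊆ M.limitRegion S r l ∧
      (M.hitValue S (l + 1) q ≤ 1 - b ∨ M.hitValue S (l + 1) q = M.expect (M.hitValue S l) q a) := by
  obtain ⟨b, hb, hb1, hgap⟩ := exists_expect_gap hS hr hc hper
  refine ⟨b, hb, hb1, fun l q hq => ?_⟩
  obtain ⟨a, ha⟩ := M.exists_bellman_eq (M.hitValue S l) q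
  rw [← hitValue_succ] at ha
  by_cases hsafe : M.post q a ⊆ M.limitRegion S r l
  · exact ⟨a, hsafe, Or.inr ha⟩
  -- The optimal action is unsafe, so the value is at most `1 - b`. An action optimal for a horizon
  -- of value at least `1 - b / 2` cannot be unsafe.
  · obtain ⟨m, hm⟩ := hq (b / 2) (by positivity)
    obtain ⟨a', ha'⟩ := M.exists_bellman_eq (M.hitValue S (l + m * r)) q
    rw [← hitValue_succ, show l + m * r + 1 = l + 1 + m * r by ring] at ha'
    refine ⟨a', ?_, Or.inl (ha ▸ hgap l q a hsafe)⟩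
    rw [← limitRegion_add_mul hS hr hc hper l m]
    by_contra hbad
    linarith [hgap (l + m * r) q a' hbad]

end Period

end Bellman

/-! ### Policies, strategies and the evolution of mass. -/

/-- The probability to be in `S` after `n` steps, if `g l` is played when `l + 1` steps remain. -/
noncomputable def policyValue (M : MDP Q A) (S : Set Q) (g : ℕ → Q → A) : ℕ → Q → ℝ
  | 0 => S.indicator 1
  | n + 1 => fun q => M.expect (policyValue M S g n) q (g n q)

/-- An optimal step averages the losses without enlarging the factor. At any other step the hitting
value is at most `1 - b`, and the bound is immediate from nonnegativity of the policy value. -/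
theorem one_sub_policyValue_le [Nonempty A] {M : MDP Q A} {S : Set Q} {D : ℕ → Set Q} {b : ℝ}
    (hb : 0 < b) (hb1 : b ≤ 1) {g : ℕ → Q → A}
    (hg : ∀ l, ∀ q ∈ D (l + 1), M.post q (g l q) ⊆ D l ∧ (M.hitValue S (l + 1) q ≤ 1 - b ∨
      M.hitValue S (l + 1) q = M.expect (M.hitValue S l) q (g l q)))
    (l : ℕ) (q : Q) (hq : q ∈ D l) :
    b * (1 - M.policyValue S g l q) ≤ 1 - M.hitValue S l q := by
  have hnn : ∀ l q, 0 ≤ M.policyValue S g l q := by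
    intro l
    induction l with
    | zero => intro q; by_cases h : q ∈ S <;> simp [policyValue, h]
    | succ n ih =>
      intro q
      exact Finset.sum_nonneg fun q' _ => mul_nonneg ((M.δ q _).2.1 q') (ih q')
  induction l generalizing q with
  | zero =>
    by_cases h : q ∈ S <;> simp [policyValue, hitValue_zero, h, hb1]
  | succ l ih =>
    obtain ⟨hsafe, h | h⟩ := hg l q hq
    · nlinarith [hnn (l + 1) q]
    · have h1 := M.expect_le_affine (u := M.hitValue S l) (v := M.policyValue S g l) (c := b)
        (d := 1 - b) (q := q) (a := g l q) fun q' hq' => by linarith [ih q' (hsafe hq')]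
      rw [← h] at h1
      simp only [policyValue]
      linarith

/-- The strategy that plays the action `σ n q` in `q` at time `n`. -/
noncomputable def markovStrategy (M : MDP Q A) (σ : ℕ → Q → A) : M.Strategy :=
  open Classical in fun n q _ => ⟨Pi.single (σ n q) 1, single_mem_stdSimplex ℝ _⟩

theorem stateProb_markovStrategy_succ (M : MDP Q A) (σ : ℕ → Q → A) (d₀ : ProbDist Q) (n : ℕ)
    (q' : Q) : M.stateProb (M.markovStrategy σ) d₀ (n + 1) q' =
      ∑ q, M.stateProb (M.markovStrategy σ) d₀ n q * (M.δ q (σ n q)).1 q' := by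
  classical
  rw [stateProb_succ]
  refine Finset.sum_congr rfl fun q _ => ?_
  rw [Finset.sum_comm, stateProb, Finset.sum_mul]
  refine Finset.sum_congr rfl fun ρ _ => ?_
  rw [← Finset.mul_sum]
  congr 1
  simp only [markovStrategy]
  rw [Finset.sum_eq_single (σ n q)]
  · simp
  · intro a _ ha
    simp [Pi.single_eq_of_ne ha]
  · simp

theorem sum_stateProb_markovStrategy_succ (M : MDP Q A) (σ : ℕ → Q → A) (d₀ : ProbDist Q) (n : ℕ)
    (u : Q → ℝ) : ∑ q, M.stateProb (M.markovStrategy σ) d₀ (n + 1) q * u q =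
      ∑ q, M.stateProb (M.markovStrategy σ) d₀ n q * M.expect u q (σ n q) := by
  simp only [stateProb_markovStrategy_succ, expect, Finset.sum_mul, Finset.mul_sum]
  rw [Finset.sum_comm]
  exact Finset.sum_congr rfl fun q _ => Finset.sum_congr rfl fun q' _ => by ring

/-- After each history the randomized choice averages over actions, so it cannot beat the best one.
-/
theorem sum_stateProb_succ_le [Nonempty A] (M : MDP Q A) (α : M.Strategy) (d₀ : ProbDist Q) (n : ℕ)
    (u : Q → ℝ) : ∑ q, M.stateProb α d₀ (n + 1) q * u q ≤
      ∑ q, M.stateProb α d₀ n q * M.bellman u q := by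
  calc ∑ q', M.stateProb α d₀ (n + 1) q' * u q'
      = ∑ q, ∑ ρ : M.FinPath n q, M.pathProb α d₀ ρ * ∑ a, (α ρ).1 a * M.expect u q a := by
        simp only [stateProb_succ, Finset.sum_mul, expect, Finset.mul_sum]
        rw [Finset.sum_comm]
        refine Finset.sum_congr rfl fun q _ => ?_
        rw [Finset.sum_comm, Finset.sum_comm (s := (Finset.univ : Finset (M.FinPath n q)))]
        refine Finset.sum_congr rfl fun a _ => ?_
        rw [Finset.sum_comm]
        exact Finset.sum_congr rfl fun ρ _ => Finset.sum_congr rfl fun q' _ => by ring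
    _ ≤ ∑ q, ∑ ρ : M.FinPath n q, M.pathProb α d₀ ρ * M.bellman u q := by
        refine Finset.sum_le_sum fun q _ => Finset.sum_le_sum fun ρ _ =>
          mul_le_mul_of_nonneg_left ?_ (M.pathProb_nonneg α d₀ ρ)
        calc ∑ a, (α ρ).1 a * M.expect u q a ≤ ∑ a, (α ρ).1 a * M.bellman u q :=
              Finset.sum_le_sum fun a _ =>
                mul_le_mul_of_nonneg_left (M.expect_le_bellman u q a) ((α ρ).2.1 a)
          _ = M.bellman u q := by rw [← Finset.sum_mul, (α ρ).2.2, one_mul]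
    _ = _ := by simp only [stateProb, Finset.sum_mul]

theorem sum_stateProb_add_le [Nonempty A] (M : MDP Q A) (α : M.Strategy) (d₀ : ProbDist Q)
    (n k : ℕ) (u : Q → ℝ) : ∑ q, M.stateProb α d₀ (n + k) q * u q ≤
      ∑ q, M.stateProb α d₀ n q * M.bellman^[k] u q := by
  induction k generalizing u with
  | zero => rfl
  | succ k ih =>
    rw [Function.iterate_succ_apply]
    exact (M.sum_stateProb_succ_le α d₀ (n + k) u).trans (ih _)

/-- The probability lost on the way from time `n` to `S` at time `n + k`. -/
theorem stateProb_mul_one_sub_hitValue_le [Nonempty A] (M : MDP Q A) (α : M.Strategy)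
    (d₀ : ProbDist Q) (S : Set Q) (n k : ℕ) (q : Q) :
    M.stateProb α d₀ n q * (1 - M.hitValue S k q) ≤
      1 - ∑ q, M.stateProb α d₀ (n + k) q * S.indicator 1 q := by
  have h1 := M.sum_stateProb_add_le α d₀ n k (S.indicator 1)
  have h2 := (M.stateProb_mem α d₀ n).2
  have h3 : M.stateProb α d₀ n q * (1 - M.hitValue S k q) ≤
      ∑ q, M.stateProb α d₀ n q * (1 - M.hitValue S k q) :=
    Finset.single_le_sum (f := fun q => M.stateProb α d₀ n q * (1 - M.hitValue S k q))
      (fun q _ => mul_nonneg ((M.stateProb_mem α d₀ n).1 q)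
      (sub_nonneg.2 (M.hitValue_le_one S k q))) (Finset.mem_univ q)
  simp only [mul_sub, mul_one, Finset.sum_sub_distrib, h2] at h3
  simp only [hitValue] at *
  linarith

/-! ### Concatenation of phases. -/

/-- The phase counter: the pair of the current phase and the number of its remaining steps, where
the phase `i` has `L i` steps. -/
def phaseCounter (L : ℕ → ℕ) : ℕ → ℕ × ℕ
  | 0 => (0, L 0)
  | t + 1 => if (phaseCounter L t).2 ≤ 1 then
      ((phaseCounter L t).1 + 1, L ((phaseCounter L t).1 + 1))
    else ((phaseCounter L t).1, (phaseCounter L t).2 - 1)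

theorem phaseCounter_pos {L : ℕ → ℕ} (hL : ∀ i, 0 < L i) (t : ℕ) : 0 < (phaseCounter L t).2 := by
  cases t with
  | zero => exact hL 0
  | succ t =>
    rw [phaseCounter]
    split_ifs with h
    · exact hL _
    · simp only; omega

theorem phaseCounter_add {L : ℕ → ℕ} {i l t : ℕ} (h : phaseCounter L t = (i, l + 1)) :
    phaseCounter L (t + (l + 1)) = (i + 1, L (i + 1)) := by
  induction l generalizing t with
  | zero => simp [phaseCounter, h]
  | succ l ih =>
    rw [show t + (l + 1 + 1) = t + 1 + (l + 1) by ring]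
    exact ih (by simp [phaseCounter, h])

theorem exists_phaseCounter_eq {L : ℕ → ℕ} (hL : ∀ i, 0 < L i) (i : ℕ) :
    ∃ t ≥ i, phaseCounter L t = (i, L i) := by
  induction i with
  | zero => exact ⟨0, le_rfl, rfl⟩
  | succ i ih =>
    obtain ⟨t, ht, h⟩ := ih
    have h0 := hL i
    obtain ⟨l, hl⟩ := Nat.exists_eq_succ_of_ne_zero h0.ne'
    exact ⟨t + (l + 1), by omega, phaseCounter_add (by rw [h, hl])⟩

/-- If the phases of a policy start in a set where its value is high, and the policy keeps the
process in these sets, then `S` is reached with high probability at the end of each phase. -/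
theorem exists_strategy_of_phases (M : MDP Q A) (S : Set Q) (g : ℕ → Q → A) (D : ℕ → Set Q)
    (hsafe : ∀ l, ∀ q ∈ D (l + 1), M.post q (g l q) ⊆ D l) (L : ℕ → ℕ) (hL : ∀ i, 0 < L i)
    (hD : ∀ i, D 0 ⊆ D (L (i + 1))) (η : ℕ → ℝ)
    (hval : ∀ i, ∀ q ∈ D (L i), 1 - η i ≤ M.policyValue S g (L i) q)
    (d₀ : ProbDist Q) (hd₀ : ∀ q, 0 < d₀.1 q → q ∈ D (L 0)) :
    ∃ α : M.Strategy, ∀ i, ∃ t > i, 1 - η i ≤ ∑ q, M.stateProb α d₀ t q * S.indicator 1 q := by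
  set σ : ℕ → Q → A := fun t => g ((phaseCounter L t).2 - 1)
  set x := M.stateProb (M.markovStrategy σ) d₀ with hx
  have hxnn : ∀ t q, 0 ≤ x t q := fun t q => (M.stateProb_mem _ d₀ t).1 q
  -- Invariant: all mass lies in the region of the current number of remaining steps; at a phase
  -- change `hD` moves it from `D 0` to the next starting region.
  have hsupp : ∀ t q, 0 < x t q → q ∈ D (phaseCounter L t).2 := by
    intro t
    induction t with
    | zero =>
      intro q hq
      rw [hx, stateProb_zero] at hq
      exact hd₀ q hq
    | succ t ih =>
      intro q' hq'
      rw [hx, stateProb_markovStrategy_succ] at hq'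
      obtain ⟨q, -, hq⟩ := Finset.exists_ne_zero_of_sum_ne_zero hq'.ne'
      obtain ⟨hq1, hq2⟩ := mul_ne_zero_iff.1 hq
      obtain ⟨l, hl⟩ := Nat.exists_eq_succ_of_ne_zero (phaseCounter_pos hL t).ne'
      have h1 := ih q ((hxnn t q).lt_of_ne' hq1)
      rw [hl] at h1
      have h2 : q' ∈ D l := hsafe l q h1 (by
        have : σ t q = g l q := by simp [σ, hl]
        rw [← this]
        exact ((M.δ q (σ t q)).2.1 q').lt_of_ne' hq2)
      rw [phaseCounter]
      split_ifs with h
      · have : l = 0 := by omega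
        exact hD _ (this ▸ h2)
      · simpa [hl] using h2
  have hvalue : ∀ l t i, phaseCounter L t = (i, l + 1) →
      ∑ q, x (t + (l + 1)) q * S.indicator 1 q = ∑ q, x t q * M.policyValue S g (l + 1) q := by
    intro l
    induction l with
    | zero =>
      intro t i h
      rw [zero_add, hx, sum_stateProb_markovStrategy_succ]
      simp [policyValue, σ, h]
    | succ l ih =>
      intro t i h
      rw [show t + (l + 1 + 1) = t + 1 + (l + 1) by ring,
        ih (t + 1) i (by simp [phaseCounter, h]), hx, sum_stateProb_markovStrategy_succ]
      simp only [policyValue, σ, h, Nat.add_sub_cancel]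
  refine ⟨M.markovStrategy σ, fun i => ?_⟩
  obtain ⟨t, ht, h⟩ := exists_phaseCounter_eq hL i
  obtain ⟨l, hl⟩ := Nat.exists_eq_succ_of_ne_zero (hL i).ne'
  refine ⟨t + (l + 1), by omega, ?_⟩
  rw [← hx, hvalue l t i (by rw [h, hl])]
  calc 1 - η i = ∑ q, x t q * (1 - η i) := by
        rw [← Finset.sum_mul, (M.stateProb_mem _ d₀ t).2, one_mul]
    _ ≤ _ := Finset.sum_le_sum fun q _ => by
        rcases (hxnn t q).eq_or_lt with h0 | h0
        · simp [← h0]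
        · have hq := hsupp t q h0
          rw [h] at hq
          have := hval i q hq
          rw [hl] at this
          exact mul_le_mul_of_nonneg_left this h0.le

/-- If `S` is limit-surely recurrent and limit-surely reachable from `d₀`, then a single strategy
from `d₀` visits `S` infinitely often with probability tending to `1`. -/
theorem IsLimitRecurrent.exists_strategy [Nonempty A] {M : MDP Q A} {S : Set Q}
    (hS : M.IsLimitRecurrent S) (d₀ : ProbDist Q)
    (hd₀ : ∀ ε > 0, ∃ n, ∀ q, d₀.1 q * (1 - M.hitValue S n q) ≤ ε) :
    ∃ α : M.Strategy, ∀ ε > 0, ∀ N : ℕ, ∃ t > N,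
      1 - ε ≤ ∑ q, M.stateProb α d₀ t q * S.indicator 1 q := by
  obtain ⟨K, r, c, hr, hc, -, hper⟩ := M.exists_period S
  obtain ⟨b, hb, hb1, hsafe⟩ := exists_safe_action hS hr hc hper
  -- Otherwise each residue modulo `r` has an initial state with persistent loss, and finitely many
  -- residues give a common bound contradicting `hd₀`.
  have hinit : ∃ j, ∀ q, 0 < d₀.1 q → q ∈ M.limitRegion S r j := by
    by_contra! hcon
    obtain ⟨ε, hε, -, h⟩ := exists_uniform_gap (ι := Fin r)
      (P := fun j ε => ∃ q, 0 < d₀.1 q ∧ ∀ m : ℕ, ε < d₀.1 q * (1 - M.hitValue S (j + m * r) q))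
      (fun j c c' _ hle ⟨q, hq, h⟩ => ⟨q, hq, fun m => hle.trans_lt (h m)⟩)
      (fun j => by
        obtain ⟨q, hq, hqj⟩ := hcon j
        simp only [limitRegion, Set.mem_ofPred_eq, not_forall, not_exists, not_le] at hqj
        obtain ⟨ε, hε, h⟩ := hqj
        exact ⟨d₀.1 q * ε, mul_pos hq hε, q, hq, fun m =>
          mul_lt_mul_of_pos_left (by linarith [h m]) hq⟩)
    obtain ⟨n, hn⟩ := hd₀ ε hε
    obtain ⟨q, -, hq⟩ := h ⟨n % r, Nat.mod_lt n hr⟩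
    have h1 := hq (n / r)
    have hl : n % r + n / r * r = n := by rw [mul_comm]; exact Nat.mod_add_div n r
    simp only [hl] at h1
    exact absurd (hn q) h1.not_ge
  obtain ⟨j, hj⟩ := hinit
  -- The numerator `b` cancels the factor `1 / b` lost by the safe policy; `m > 0` keeps phases
  -- nonempty when `k = 0`.
  have hlen : ∀ i k : ℕ, ∃ m > 0, ∀ q ∈ M.limitRegion S r k,
      1 - b / (i + 1) ≤ M.hitValue S (k + m * r) q := by
    intro i k
    have : ∀ᶠ m : ℕ in atTop, ∀ q, q ∈ M.limitRegion S r k →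
        1 - b / (i + 1) ≤ M.hitValue S (k + m * r) q := by
      refine eventually_all.2 fun q => ?_
      by_cases hq : q ∈ M.limitRegion S r k
      · filter_upwards [eventually_le_hitValue_of_mem_limitRegion hS hr hc hper hq
          (ε := b / (i + 1)) (by positivity)] with m hm _ using hm
      · exact Eventually.of_forall fun m h => absurd h hq
    obtain ⟨m, hm, hm0⟩ := (this.and (eventually_gt_atTop 0)).exists
    exact ⟨m, hm0, hm⟩
  choose m hm0 hm using hlen
  have hact : ∀ l q, ∃ a, q ∈ M.limitRegion S r (l + 1) → M.post q a ⊆ M.limitRegion S r l ∧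
      (M.hitValue S (l + 1) q ≤ 1 - b ∨
        M.hitValue S (l + 1) q = M.expect (M.hitValue S l) q a) := by
    intro l q
    by_cases hq : q ∈ M.limitRegion S r (l + 1)
    · obtain ⟨a, ha⟩ := hsafe l q hq
      exact ⟨a, fun _ => ha⟩
    · exact ⟨Classical.arbitrary A, fun h => absurd h hq⟩
  choose g hg using hact
  -- Only the first phase starts in region `j`; later ones start in region `0`, where their
  -- predecessor ended.
  set k : ℕ → ℕ := fun i => if i = 0 then j else 0
  obtain ⟨α, hα⟩ := M.exists_strategy_of_phases S g (M.limitRegion S r) (fun l q hq => (hg l q hq).1)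
    (fun i => k i + m i (k i) * r) (fun i => by have := Nat.mul_pos (hm0 i (k i)) hr; omega)
    (fun i => by rw [limitRegion_add_mul hS hr hc hper]; simp [k])
    (fun i => 1 / (i + 1)) (fun i q hq => by
      have h1 := one_sub_policyValue_le hb hb1 hg _ q hq
      rw [limitRegion_add_mul hS hr hc hper] at hq
      have h2 := hm i (k i) q hq
      have h3 : b * (1 - M.policyValue S g (k i + m i (k i) * r) q) ≤ b * (1 / (i + 1)) := by
        rw [mul_one_div]
        linarith
      linarith [le_of_mul_le_mul_left h3 hb]) d₀
    (fun q hq => by rw [limitRegion_add_mul hS hr hc hper]; simpa [k] using hj q hq)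
  refine ⟨α, fun ε hε N => ?_⟩
  obtain ⟨i, hi⟩ := exists_nat_one_div_lt hε
  obtain ⟨t, ht, h⟩ := hα (max i N)
  refine ⟨t, lt_of_le_of_lt (le_max_right _ _) ht, le_trans ?_ h⟩
  have : (1 : ℝ) / ((max i N : ℕ) + 1) ≤ 1 / (i + 1) :=
    one_div_le_one_div_of_le (by positivity) (by
      have : (i : ℝ) ≤ (max i N : ℕ) := Nat.cast_le.2 (le_max_left _ _)
      linarith)
  linarith

/-! ### Compactness and the main theorem. -/

/-- The distributions that are `p`-synchronized in `T` form a compact set. -/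
theorem isCompact_setOf_le_sum (T : Finset Q) (p : ℝ) :
    IsCompact (stdSimplex ℝ Q ∩ {x | p ≤ ∑ q ∈ T, x q}) :=
  (isCompact_stdSimplex ℝ Q).inter_right
    (isClosed_le continuous_const (continuous_finsetSum _ fun q _ => continuous_apply q))

/-- Limit-sure winning runs recur near a single distribution supported in `T`. -/
theorem exists_recurrent_dist {M : MDP Q A} {T : Finset Q} {d₀ : ProbDist Q}
    (h : d₀ ∈ M.winLimitSureWeakly (sumOn T)) :
    ∃ e ∈ stdSimplex ℝ Q, (∀ q, 0 < e q → q ∈ T) ∧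
      ∀ η > 0, ∃ α : M.Strategy, ∃ᶠ n in atTop, ∀ q, |M.stateProb α d₀ n q - e q| < η := by
  have hk : ∀ k : ℕ, ∃ α : M.Strategy,
      ∃ e ∈ stdSimplex ℝ Q ∩ {x | 1 - 1 / ((k : ℝ) + 1) ≤ ∑ q ∈ T, x q},
        MapClusterPt e atTop (M.stateProb α d₀) := by
    intro k
    obtain ⟨α, hα⟩ := h (1 / (k + 1)) (by positivity)
    have hfreq : ∃ᶠ n in atTop, M.stateProb α d₀ n ∈
        stdSimplex ℝ Q ∩ {x | 1 - 1 / ((k : ℝ) + 1) ≤ ∑ q ∈ T, x q} :=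
      (Nat.frequently_atTop_iff_infinite.2 hα).mono fun n hn => ⟨M.stateProb_mem α d₀ n, hn⟩
    obtain ⟨e, he, hcl⟩ := (isCompact_setOf_le_sum T _).exists_mapClusterPt_of_frequently hfreq
    exact ⟨α, e, he, hcl⟩
  choose α e he hcl using hk
  -- A cluster point of cluster points: `f` puts mass 1 on `T`, and a suitable `α k` recurs near it.
  obtain ⟨f, hf, hfcl⟩ := (isCompact_stdSimplex ℝ Q).exists_mapClusterPt_of_frequently
    (l := atTop) (f := e) (Frequently.of_forall fun k => (he k).1)
  have hfT : ∀ k : ℕ, 1 - 1 / ((k : ℝ) + 1) ≤ ∑ q ∈ T, f q := by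
    intro k
    have hclosed : IsClosed {x : Q → ℝ | 1 - 1 / ((k : ℝ) + 1) ≤ ∑ q ∈ T, x q} :=
      isClosed_le continuous_const (continuous_finsetSum T fun q _ => continuous_apply q)
    refine hclosed.mem_of_mapClusterPt hfcl ?_
    filter_upwards [eventually_ge_atTop k] with i hi
    have h1 := (he i).2
    have h2 : (1 : ℝ) / (i + 1) ≤ 1 / (k + 1) :=
      one_div_le_one_div_of_le (by positivity) (by
        have : (k : ℝ) ≤ i := Nat.cast_le.2 hi
        linarith)
    simp only [Set.mem_ofPred_eq] at h1 ⊢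
    linarith
  have hfT1 : 1 ≤ ∑ q ∈ T, f q := by
    refine le_of_forall_pos_lt_add fun ε hε => ?_
    obtain ⟨k, hk⟩ := exists_nat_one_div_lt hε
    linarith [hfT k]
  refine ⟨f, hf, fun q hq => ?_, fun η hη => ?_⟩
  · classical
    by_contra hqT
    have h1 : ∑ x ∈ insert q T, f x ≤ ∑ x, f x :=
      Finset.sum_le_sum_of_subset_of_nonneg (Finset.subset_univ _) fun x _ _ => hf.1 x
    rw [Finset.sum_insert hqT, hf.2] at h1
    linarith
  · obtain ⟨k, hk⟩ := (hfcl.frequently (Metric.ball_mem_nhds f (half_pos hη))).exists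
    refine ⟨α k, ((hcl k).frequently (Metric.ball_mem_nhds (e k) (half_pos hη))).mono
      fun n hn q => ?_⟩
    have h1 : dist (M.stateProb (α k) d₀ n) f < η := by
      have := dist_triangle (M.stateProb (α k) d₀ n) (e k) f
      linarith
    rw [← Real.dist_eq]
    exact (dist_le_pi_dist _ _ q).trans_lt h1

/-- A distribution close to `e` puts almost all its mass on the support of `e`. -/
theorem one_sub_le_sum_mul_indicator {x e : Q → ℝ} (he : e ∈ stdSimplex ℝ Q)
    (hx : x ∈ stdSimplex ℝ Q) {η : ℝ} (h : ∀ q, |x q - e q| < η) :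
    1 - Fintype.card Q * η ≤ ∑ q, x q * {q | 0 < e q}.indicator (1 : Q → ℝ) q := by
  calc 1 - Fintype.card Q * η = ∑ q, (e q - η) := by
        simp [Finset.sum_sub_distrib, he.2]
    _ ≤ _ := Finset.sum_le_sum fun q _ => by
        have h1 := (abs_lt.1 (h q))
        by_cases hq : 0 < e q
        · simp only [Set.mem_ofPred_eq, hq, Set.indicator_of_mem, Pi.one_apply]
          linarith
        · have h2 := he.1 q
          have h3 := hx.1 q
          simp only [Set.mem_ofPred_eq, hq, not_false_eq_true, Set.indicator_of_notMem]
          linarith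

end MDP

theorem mainTheorem1 {Q A : Type*} [Fintype Q] [Fintype A] (M : MDP Q A) (T : Finset Q) :
    M.winLimitSureWeakly (sumOn T) = M.winAlmostSureWeakly (sumOn T) := by
  refine Set.Subset.antisymm (fun d₀ h => ?_) fun d₀ ⟨α, hα⟩ ε hε => ⟨α, hα ε hε⟩
  have hQ : Nonempty Q := by
    by_contra hQ
    rw [not_nonempty_iff] at hQ
    simpa using d₀.2.2
  have hA : Nonempty A := by
    obtain ⟨α, -⟩ := h 1 one_pos
    by_contra hA
    rw [not_nonempty_iff] at hA
    simpa using (α (.nil (Classical.arbitrary Q))).2.2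
  obtain ⟨e, he, heT, hrec⟩ := MDP.exists_recurrent_dist h
  set S : Set Q := {q | 0 < e q} with hSdef
  have hcard : (0 : ℝ) < Fintype.card Q := Nat.cast_pos.2 Fintype.card_pos
  have hS : M.IsLimitRecurrent S := by
    intro ε hε
    obtain ⟨μ, hμ, -, hμe⟩ := MDP.exists_uniform_gap (ι := Q) (P := fun q μ => q ∈ S → μ ≤ e q)
      (fun q c c' _ hle h hq => hle.trans (h hq))
      (fun q => by
        by_cases hq : q ∈ S
        · exact ⟨e q, hq, fun _ => le_rfl⟩
        · exact ⟨1, one_pos, fun h => absurd h hq⟩)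
    -- The first bound leaves mass at least `μ / 2` on each state of `S` at time `m`; the second
    -- limits the mass outside `S` at the later time to `μ / 2 * ε`.
    obtain ⟨α, hα⟩ := hrec (min (μ / 2) (μ / 2 * ε / Fintype.card Q)) (by positivity)
    obtain ⟨m, -, hm⟩ := Filter.frequently_atTop.1 hα 0
    obtain ⟨n, hn, hn'⟩ := Filter.frequently_atTop.1 hα (m + 1)
    obtain ⟨k, rfl⟩ := Nat.exists_eq_add_of_le hn
    refine ⟨1 + k, by omega, fun q hq => ?_⟩
    have h1 := M.stateProb_mul_one_sub_hitValue_le α d₀ S m (1 + k) q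
    rw [← add_assoc] at h1
    have h2 := MDP.one_sub_le_sum_mul_indicator he (M.stateProb_mem α d₀ _)
      fun q => (hn' q).trans_le (min_le_right _ _)
    rw [mul_div_cancel₀ _ hcard.ne'] at h2
    have h3 := (abs_lt.1 ((hm q).trans_le (min_le_left _ _))).1
    have h4 := hμe q hq
    have h5 : μ / 2 * (1 - M.hitValue S (1 + k) q) ≤ μ / 2 * ε := by
      refine le_trans (mul_le_mul_of_nonneg_right ?_
        (sub_nonneg.2 (M.hitValue_le_one S (1 + k) q))) (h1.trans (by linarith))
      linarith
    linarith [le_of_mul_le_mul_left h5 (half_pos hμ)]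
  -- Reachability from `d₀` is the same mass estimate started at time 0.
  obtain ⟨α, hα⟩ := hS.exists_strategy d₀ fun ε hε => by
    obtain ⟨α, hα⟩ := hrec (ε / Fintype.card Q) (by positivity)
    obtain ⟨n, -, hn⟩ := Filter.frequently_atTop.1 hα 0
    refine ⟨n, fun q => ?_⟩
    have h1 := M.stateProb_mul_one_sub_hitValue_le α d₀ S 0 n q
    have h2 := MDP.one_sub_le_sum_mul_indicator he (M.stateProb_mem α d₀ _) hn
    rw [mul_div_cancel₀ _ hcard.ne'] at h2
    rw [M.stateProb_zero, zero_add] at h1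
    linarith
  refine ⟨α, fun ε hε => Set.infinite_of_forall_exists_gt fun N => ?_⟩
  obtain ⟨t, ht, h⟩ := hα ε hε N
  refine ⟨t, h.trans ?_, ht⟩
  classical
  calc ∑ q, M.stateProb α d₀ t q * S.indicator 1 q
      ≤ ∑ q, if q ∈ T then M.stateProb α d₀ t q else 0 := by
        refine Finset.sum_le_sum fun q _ => ?_
        have h0 := (M.stateProb_mem α d₀ t).1 q
        by_cases hq : q ∈ S
        · simp [hq, heT q hq]
        · by_cases hT : q ∈ T <;> simp [hq, hT, h0]
    _ = sumOn T (M.outcome α d₀ t) := by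
        simp [sumOn, MDP.outcome]
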